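/- For symmetric $n\times n$ matrices write $A\bullet B=\sum_{i,j}A_{ij}B_{ij}$, let $\mathbb S^n$ be the space of real symmetric $n\times n$ matrices and $\mathbb S^n_+$ the cone of positive semidefinite ones. Let $A_0,A_1,\dots,A_m\in\mathbb S^n$, $b\in\mathbb R^m$, and consider the semidefinite programs $$(P)\ \sup_{y,Z}\Big\{b^Ty : A_0-\sum_{k=1}^m y_kA_k=Z,\ y\in\mathbb R^m,\ Z\in\mathbb S^n_+\Big\},\qquad (D)\ \inf_X\{A_0\bullet X : A_k\bullet X=b_k\ (1\le k\le m),\ X\in\mathbb S^n_+\}.$$ For $t\ge 0$ let $E_1(t),\dots,E_m(t)\in\mathbb S^n$ be continuous at $t=0$ with $E_k(0)=O$, and let $$(D_t)\ \inf_X\{A_0\bullet X : (A_k+E_k(t))\bullet X=b_k\ (1\le k\le m),\ X\in\mathbb S^n_+\}.$$ A face of a convex set $C$ is a convex subset $F\subseteq C$ such that, whenever $x_1,x_2\in C$ and the open segment $(x_1,x_2)$ meets $F$, both $x_1,x_2\in F$. The minimal face of $(D)$, denoted $F_{\min}$, is the intersection of all faces of $\mathbb S^n_+$ that contain the feasible region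 of $(D)$; the minimal face of $(D_t)$ is defined in the same way. For $F\subseteq\mathbb S^n$ put $F^\perp=\{Z\in\mathbb S^n: Z\bullet X=0\ \forall X\in F\}$. A facial reduction sequence of $(D)$ is a finite sequence $(\hat y^i,\widehat U^i,\widehat V^i)_{i=1}^s$ for which there are sets $F_0=\mathbb S^n_+,F_1,\dots,F_s=F_{\min}$ such that for every $i=1,\dots,s$: $\hat y^i\in\mathbb R^m$, $\widehat U^i\in\mathbb S^n_+$, $\widehat V^i\in F_{i-1}^\perp$, $b^T\hat y^i=0$, $-\sum_k\hat y^i_kA_k=\widehat U^i+\widehat V^i\notin F_{i-1}^\perp$, and $F_i=F_{i-1}\cap\{X: X\bullet\widehat U^i=0\}$. Assume that 1. (Condition D) $(D)$ is feasible; $(P)$ is strictly feasible, i.e. $A_0-\sum_k y_kA_k$ is positive definite for some $y\in\mathbb R^m$; $A_1,\dots,A_m$ are linearly independent; and $(D_t)$ is feasible for all sufficiently small $t>0$. 2. (Rank condition) For some $0\le r\le n$ and some orthogonal matrix $Q$ with $F_{\min}=\left\{Q\begin{pmatrix}O&O\\O&X\end{pmatrix}Q^T: X\in\mathbb S^r_+\right\}$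 there is $\delta>0$ such that for all $0\le t\le\delta$ $$\dim\big\langle (Q^T(A_1+E_1(t))Q)_3,\dots,(Q^T(A_m+E_m(t))Q)_3\big\rangle=\dim\big\langle (Q^TA_1Q)_3,\dots,(Q^TA_mQ)_3\big\rangle,$$ where $M_3$ denotes the lower right $r\times r$ block of $M$ and $\langle\cdot\rangle$ the linear span. 3. For some facial reduction sequence $(\hat y^i,\widehat U^i,\widehat V^i)_{i=1}^s$ of $(D)$, the perturbations have, for all sufficiently small $t>0$, the form $E_k(t)=w_k(t)E(t)$ $(k=1,\dots,m)$ with $E(t)\in\mathbb S^n$, $E(t)\to O$ as $t\downarrow 0$, and $w(t)=(w_1(t),\dots,w_m(t))\in\langle\hat y^1,\dots,\hat y^s\rangle^\perp\subseteq\mathbb R^m$. Then for all sufficiently small $t>0$ the minimal face of $(D_t)$ is equal to the minimal face of $(D)$. -/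

import Mathlib

open Filter Topology

noncomputable section

namespace SDPFace

/-- The inner product `A • B = ∑ i, j, A i j * B i j` of real `n × n` matrices. -/
def frob {n : ℕ} (A B : Matrix (Fin n) (Fin n) ℝ) : ℝ := ∑ i, ∑ j, A i j * B i j

/-- The cone of real symmetric positive semidefinite `n × n` matrices. -/
def psdCone (n : ℕ) : Set (Matrix (Fin n) (Fin n) ℝ) := {X | X.PosSemidef}

/-- `F` is a face of the convex set `C`: a convex subset of `C` such that, whenever the open
segment between two points of `C` meets `F`, both points lie in `F`. -/
def IsFace {V : Type*} [AddCommGroup V] [Module ℝ V] (C F : Set V) : Prop :=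
  Convex ℝ F ∧ IsExtreme ℝ C F

/-- The minimal face of `C` containing `S`: the intersection of all faces of `C` containing `S`. -/
def minimalFace {V : Type*} [AddCommGroup V] [Module ℝ V] (C S : Set V) : Set V :=
  ⋂₀ {F | IsFace C F ∧ S ⊆ F}

/-- The orthogonal complement of `F` within the symmetric matrices. -/
def symmPerp {n : ℕ} (F : Set (Matrix (Fin n) (Fin n) ℝ)) : Set (Matrix (Fin n) (Fin n) ℝ) :=
  {Z | Z.IsSymm ∧ ∀ X ∈ F, frob Z X = 0}

/-- The feasible region of the dual problem
`inf {A₀ • X : A k • X = b k for all k, X positive semidefinite}`. -/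
def feasibleD {n m : ℕ} (A : Fin m → Matrix (Fin n) (Fin n) ℝ) (b : EuclideanSpace ℝ (Fin m)) :
    Set (Matrix (Fin n) (Fin n) ℝ) :=
  {X | X ∈ psdCone n ∧ ∀ k, frob (A k) X = b k}

/-- Strict feasibility of the primal problem
`sup {bᵀ y : A₀ - ∑ k, y k • A k = Z, Z positive semidefinite}`. -/
def StrictlyFeasibleP {n m : ℕ} (A₀ : Matrix (Fin n) (Fin n) ℝ)
    (A : Fin m → Matrix (Fin n) (Fin n) ℝ) : Prop :=
  ∃ (y : EuclideanSpace ℝ (Fin m)) (Z : Matrix (Fin n) (Fin n) ℝ),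
    A₀ - ∑ k, y k • A k = Z ∧ Z.PosDef

/-- The minimal face of the dual problem. -/
def minFaceD {n m : ℕ} (A : Fin m → Matrix (Fin n) (Fin n) ℝ) (b : EuclideanSpace ℝ (Fin m)) :
    Set (Matrix (Fin n) (Fin n) ℝ) :=
  minimalFace (psdCone n) (feasibleD A b)

/-- `(y, U, V)` is a reducing certificate at the face `F`, that is, a solution of the
discriminant system. -/
def IsReducingCertificate {n m : ℕ} (A : Fin m → Matrix (Fin n) (Fin n) ℝ)
    (b : EuclideanSpace ℝ (Fin m)) (F : Set (Matrix (Fin n) (Fin n) ℝ))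
    (y : EuclideanSpace ℝ (Fin m)) (U V : Matrix (Fin n) (Fin n) ℝ) : Prop :=
  U ∈ psdCone n ∧ V ∈ symmPerp F ∧ ∑ k, b k * y k = 0 ∧ -∑ k, y k • A k = U + V ∧
    U + V ∉ symmPerp F

/-- A facial reduction sequence for the dual problem: starting from the whole cone, each step
intersects the current face with `{U i}^⊥` for a reducing certificate `(y i, U i, V i)` at that
face, and the last face is the minimal face. -/
def IsFacialReductionSequence {n m s : ℕ} (A : Fin m → Matrix (Fin n) (Fin n) ℝ)
    (b : EuclideanSpace ℝ (Fin m)) (y : Fin s → EuclideanSpace ℝ (Fin m))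
    (U V : Fin s → Matrix (Fin n) (Fin n) ℝ) : Prop :=
  ∃ F : Fin (s + 1) → Set (Matrix (Fin n) (Fin n) ℝ),
    F 0 = psdCone n ∧
    (∀ i : Fin s, IsReducingCertificate A b (F i.castSucc) (y i) (U i) (V i) ∧
      F i.succ = F i.castSucc ∩ {X | frob X (U i) = 0}) ∧
    F (Fin.last s) = minFaceD A b

/-- The splitting of the indices into the first `n - r` and the last `r` ones. -/
def splitEquiv {n r : ℕ} (h : r ≤ n) : Fin (n - r) ⊕ Fin r ≃ Fin n :=
  finSumFinEquiv.trans (finCongr (Nat.sub_add_cancel h))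

/-- The `n × n` matrix with lower right block `X` and zeros elsewhere. -/
def embedLowerRight {n r : ℕ} (h : r ≤ n) (X : Matrix (Fin r) (Fin r) ℝ) :
    Matrix (Fin n) (Fin n) ℝ :=
  (Matrix.fromBlocks 0 0 0 X).reindex (splitEquiv h) (splitEquiv h)

/-- The lower right `r × r` block `M₃` of `M`. -/
def lowerRight {n r : ℕ} (h : r ≤ n) (M : Matrix (Fin n) (Fin n) ℝ) :
    Matrix (Fin r) (Fin r) ℝ :=
  (M.reindex (splitEquiv h).symm (splitEquiv h).symm).toBlocks₂₂

/-- The rank condition for the perturbations `A k + E k t`: with an orthogonal matrix `Q`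
associated to the minimal face of the unperturbed dual problem, the rank of the span of the blocks
`(Qᵀ (A k + E k t) Q)₃` is constant on some interval `[0, δ]`. -/
def RankCondition {n m : ℕ} (A : Fin m → Matrix (Fin n) (Fin n) ℝ)
    (b : EuclideanSpace ℝ (Fin m)) (E : Fin m → ℝ → Matrix (Fin n) (Fin n) ℝ) : Prop :=
  ∃ (r : ℕ) (h : r ≤ n), ∃ Q ∈ Matrix.orthogonalGroup (Fin n) ℝ,
    minFaceD A b = {Y | ∃ X ∈ psdCone r, Y = Q * embedLowerRight h X * Q.transpose} ∧
    ∃ δ > (0 : ℝ), ∀ t ∈ Set.Icc 0 δ,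
      Module.finrank ℝ (Submodule.span ℝ
          (Set.range fun k => lowerRight h (Q.transpose * (A k + E k t) * Q))) =
        Module.finrank ℝ (Submodule.span ℝ
          (Set.range fun k => lowerRight h (Q.transpose * A k * Q)))

/-- The standing conditions: the dual problem is feasible and the primal problem strictly
feasible, the coefficient matrices are linearly independent, and the perturbed dual problem is
feasible for all sufficiently small `t > 0`. -/
structure ConditionD {n m : ℕ} (A₀ : Matrix (Fin n) (Fin n) ℝ)
    (A : Fin m → Matrix (Fin n) (Fin n) ℝ) (b : EuclideanSpace ℝ (Fin m))
    (E : Fin m → ℝ → Matrix (Fin n) (Fin n) ℝ) : Prop where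
  dual_feasible : (feasibleD A b).Nonempty
  primal_strictly_feasible : StrictlyFeasibleP A₀ A
  linearIndependent : LinearIndependent ℝ A
  perturbed_feasible : ∀ᶠ t in 𝓝[>] (0 : ℝ), (feasibleD (fun k => A k + E k t) b).Nonempty

end SDPFace

end

/-! Two inclusions. Since `w t` is orthogonal to every certificate `y i`, the combinations `∑ k, y i
k • E k t` vanish, so the identities `-∑ k, y i k • A k = U i + V i` survive the perturbation. The
old reduction therefore confines the perturbed feasible region, hence its minimal face, to `minFaceD
A b` (`feasibleD_add_subset_minFaceD`).

Conversely, `minFaceD A b` contains a feasible point whose block `P₀` is positive definite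
(`exists_posDef_feasibleD`). By the first inclusion the perturbed constraints, reduced to `r × r`
blocks, are consistent; with constant rank, `P₀` then extends to solutions `P t → P₀`
(`exists_tendsto_frob_eq`). For small `t` the block `P t` is positive definite, so it gives a
perturbed feasible point in the relative interior of `minFaceD A b`, and every face through that
point contains the whole of it (`subset_isFace_of_posDef`). -/

namespace SDPFace

open Matrix

/-! ### The trace inner product. -/

section Frobenius

variable {n r : ℕ}

lemma frob_eq_trace (A B : Matrix (Fin n) (Fin n) ℝ) : frob A B = (Aᵀ * B).trace := by
  simp only [frob, trace, diag_apply, mul_apply, transpose_apply]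
  exact Finset.sum_comm

lemma frob_comm (A B : Matrix (Fin n) (Fin n) ℝ) : frob A B = frob B A := by
  simp only [frob, mul_comm]

lemma frob_add_left (A B C : Matrix (Fin n) (Fin n) ℝ) :
    frob (A + B) C = frob A C + frob B C := by
  simp only [frob_eq_trace, transpose_add, add_mul, trace_add]

lemma frob_smul_left (c : ℝ) (A B : Matrix (Fin n) (Fin n) ℝ) :
    frob (c • A) B = c * frob A B := by
  simp only [frob_eq_trace, transpose_smul, smul_mul, trace_smul, smul_eq_mul]

lemma frob_neg_left (A B : Matrix (Fin n) (Fin n) ℝ) : frob (-A) B = -frob A B := by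
  simp only [frob_eq_trace, transpose_neg, neg_mul, trace_neg]

lemma frob_sum_left {ι : Type*} (s : Finset ι) (A : ι → Matrix (Fin n) (Fin n) ℝ)
    (B : Matrix (Fin n) (Fin n) ℝ) : frob (∑ i ∈ s, A i) B = ∑ i ∈ s, frob (A i) B := by
  simp only [frob_eq_trace, transpose_sum, Finset.sum_mul, trace_sum]

lemma frob_add_right (A B C : Matrix (Fin n) (Fin n) ℝ) :
    frob A (B + C) = frob A B + frob A C := by
  simp only [frob_eq_trace, mul_add, trace_add]

lemma frob_smul_right (c : ℝ) (A B : Matrix (Fin n) (Fin n) ℝ) :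
    frob A (c • B) = c * frob A B := by
  rw [frob_comm, frob_smul_left, frob_comm]

lemma frob_sum_right {ι : Type*} (s : Finset ι) (A : Matrix (Fin n) (Fin n) ℝ)
    (B : ι → Matrix (Fin n) (Fin n) ℝ) : frob A (∑ i ∈ s, B i) = ∑ i ∈ s, frob A (B i) := by
  simp only [frob_eq_trace, Finset.mul_sum, trace_sum]

lemma eq_zero_of_frob_self {A : Matrix (Fin n) (Fin n) ℝ} (h : frob A A = 0) : A = 0 := by
  rw [frob_eq_trace, ← conjTranspose_eq_transpose_of_trivial] at h
  exact trace_conjTranspose_mul_self_eq_zero_iff.mp h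

lemma frob_mul_mul_transpose (M Q Z : Matrix (Fin n) (Fin n) ℝ) :
    frob M (Q * Z * Qᵀ) = frob (Qᵀ * M * Q) Z := by
  rw [frob_eq_trace, frob_eq_trace, ← mul_assoc, trace_mul_comm]
  simp only [transpose_mul, transpose_transpose, mul_assoc]

/-- With `frob_mul_mul_transpose`, this turns constraints on the face `Q (0 ⊕ 𝕊₊) Qᵀ` into
constraints on `r × r` blocks. -/
lemma frob_embedLowerRight (h : r ≤ n) (M : Matrix (Fin n) (Fin n) ℝ)
    (X : Matrix (Fin r) (Fin r) ℝ) :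
    frob M (embedLowerRight h X) = frob (lowerRight h M) X := by
  simp [frob, embedLowerRight, lowerRight, ← (splitEquiv h).sum_comp, toBlocks₂₂]

end Frobenius

/-! ### Lower right blocks. -/

section Blocks

variable {n r : ℕ} (h : r ≤ n)

lemma lowerRight_embedLowerRight (X : Matrix (Fin r) (Fin r) ℝ) :
    lowerRight h (embedLowerRight h X) = X := by
  ext i j
  simp [embedLowerRight, lowerRight, toBlocks₂₂]

lemma embedLowerRight_add (X Y : Matrix (Fin r) (Fin r) ℝ) :
    embedLowerRight h (X + Y) = embedLowerRight h X + embedLowerRight h Y := by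
  ext i j
  obtain ⟨i, rfl⟩ := (splitEquiv h).surjective i
  obtain ⟨j, rfl⟩ := (splitEquiv h).surjective j
  rcases i with i | i <;> rcases j with j | j <;> simp [embedLowerRight]

lemma embedLowerRight_smul (c : ℝ) (X : Matrix (Fin r) (Fin r) ℝ) :
    embedLowerRight h (c • X) = c • embedLowerRight h X := by
  ext i j
  obtain ⟨i, rfl⟩ := (splitEquiv h).surjective i
  obtain ⟨j, rfl⟩ := (splitEquiv h).surjective j
  rcases i with i | i <;> rcases j with j | j <;> simp [embedLowerRight]

lemma lowerRight_add (X Y : Matrix (Fin n) (Fin n) ℝ) :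
    lowerRight h (X + Y) = lowerRight h X + lowerRight h Y := rfl

lemma lowerRight_smul (c : ℝ) (X : Matrix (Fin n) (Fin n) ℝ) :
    lowerRight h (c • X) = c • lowerRight h X := rfl

lemma continuous_lowerRight : Continuous (lowerRight h) := by
  refine continuous_matrix fun i j => ?_
  exact continuous_id.matrix_elem _ _

lemma isSymm_lowerRight {X : Matrix (Fin n) (Fin n) ℝ} (hX : X.IsSymm) :
    (lowerRight h X).IsSymm := by
  ext i j
  exact hX.apply _ _

lemma posSemidef_lowerRight {X : Matrix (Fin n) (Fin n) ℝ} (hX : X.PosSemidef) :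
    (lowerRight h X).PosSemidef :=
  hX.submatrix fun i => splitEquiv h (Sum.inr i)

lemma lowerRight_conj_embedLowerRight {Q : Matrix (Fin n) (Fin n) ℝ}
    (hQ : Q ∈ orthogonalGroup (Fin n) ℝ) (X : Matrix (Fin r) (Fin r) ℝ) :
    lowerRight h (Qᵀ * (Q * embedLowerRight h X * Qᵀ) * Q) = X := by
  have hQ' : Qᵀ * Q = 1 := by
    simpa [star_eq_conjTranspose] using (mem_orthogonalGroup_iff' (Fin n) ℝ).mp hQ
  have : Qᵀ * (Q * embedLowerRight h X * Qᵀ) * Q = embedLowerRight h X := by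
    calc _ = (Qᵀ * Q) * embedLowerRight h X * (Qᵀ * Q) := by simp only [mul_assoc]
      _ = _ := by simp [hQ']
  rw [this, lowerRight_embedLowerRight]

end Blocks

/-! ### Openness and existence of positive definite matrices. -/

section PosDef

variable {n : ℕ}

/-- Positive definiteness is an open condition among the symmetric matrices. -/
lemma eventually_posDef_of_posDef {P : Matrix (Fin n) (Fin n) ℝ} (hP : P.PosDef) :
    ∀ᶠ X in 𝓝 P, X.IsSymm → X.PosDef := by
  have hc : Continuous fun z : Matrix (Fin n) (Fin n) ℝ × EuclideanSpace ℝ (Fin n) =>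
      z.2.ofLp ⬝ᵥ z.1 *ᵥ z.2.ofLp := by
    have h2 : Continuous fun z : Matrix (Fin n) (Fin n) ℝ × EuclideanSpace ℝ (Fin n) =>
        z.2.ofLp := (PiLp.continuous_ofLp 2 _).comp continuous_snd
    exact h2.dotProduct (continuous_fst.matrix_mulVec h2)
  have hev : ∀ᶠ X in 𝓝 P, ∀ x ∈ Metric.sphere (0 : EuclideanSpace ℝ (Fin n)) 1,
      0 < x.ofLp ⬝ᵥ X *ᵥ x.ofLp := by
    -- Compactness of the sphere makes one neighbourhood of `P` serve all unit vectors.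
    refine (isCompact_sphere 0 1).eventually_forall_of_forall_eventually fun x hx => ?_
    have hx0 : x.ofLp ≠ 0 := by
      intro h0
      have : x = 0 := by ext i; exact congrFun h0 i
      simp [this] at hx
    have := hP.dotProduct_mulVec_pos hx0
    exact (hc.tendsto (P, x)).eventually (lt_mem_nhds (by simpa using this))
  filter_upwards [hev] with X hX hs
  refine PosDef.of_dotProduct_mulVec_pos ?_ fun x hx => ?_
  · rwa [IsHermitian, conjTranspose_eq_transpose_of_trivial]
  · set v : EuclideanSpace ℝ (Fin n) := WithLp.toLp 2 x with hv
    have hv0 : v ≠ 0 := by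
      intro h0
      exact hx (by simpa [hv] using h0)
    have hpos : 0 < ‖v‖ := norm_pos_iff.mpr hv0
    have hmem : ‖v‖⁻¹ • v ∈ Metric.sphere (0 : EuclideanSpace ℝ (Fin n)) 1 := by
      simp [norm_smul, hpos.ne']
    have h1 := hX _ hmem
    have h2 : (‖v‖⁻¹ • v).ofLp = ‖v‖⁻¹ • x := rfl
    rw [h2, mulVec_smul, smul_dotProduct, dotProduct_smul, smul_smul, smul_eq_mul] at h1
    simpa using pos_of_mul_pos_right h1 (by positivity)

/-- A nonempty convex set of positive semidefinite matrices without a common isotropic vector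
contains a positive definite matrix. -/
lemma exists_posDef_mem_of_convex {S : Set (Matrix (Fin n) (Fin n) ℝ)} (hS : Convex ℝ S)
    (hne : S.Nonempty) (hpsd : S ⊆ psdCone n)
    (hv : ∀ v : Fin n → ℝ, v ≠ 0 → ∃ P ∈ S, v ⬝ᵥ P *ᵥ v ≠ 0) : ∃ P ∈ S, P.PosDef := by
  -- Take a kernel of least dimension: a nonzero `v` in it could be removed by averaging `P` with
  -- some `R ∈ S` that is not isotropic at `v`.
  obtain ⟨P, hPS, hmin⟩ := (measure fun P : Matrix (Fin n) (Fin n) ℝ =>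
    Module.finrank ℝ (LinearMap.ker P.mulVecLin)).wf.has_min S hne
  refine ⟨P, hPS, ?_⟩
  have hP : P.PosSemidef := hpsd hPS
  refine PosDef.of_dotProduct_mulVec_pos hP.1 fun v hv0 => ?_
  refine lt_of_le_of_ne (hP.dotProduct_mulVec_nonneg v) fun h0 => ?_
  obtain ⟨R, hRS, hR⟩ := hv v hv0
  have hRp : R.PosSemidef := hpsd hRS
  have hPv : P *ᵥ v = 0 := (hP.dotProduct_mulVec_zero_iff v).mp h0.symm
  refine hmin _ (hS hPS hRS (a := 1 / 2) (b := 1 / 2) (by norm_num) (by norm_num) (by norm_num))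
    (Submodule.finrank_lt_finrank_of_lt ?_)
  have key : ∀ x, ((1 / 2 : ℝ) • P + (1 / 2 : ℝ) • R) *ᵥ x = 0 → P *ᵥ x = 0 ∧ R *ᵥ x = 0 := by
    intro x hx
    have h1 := hP.dotProduct_mulVec_nonneg x
    have h2 := hRp.dotProduct_mulVec_nonneg x
    have h3 : star x ⬝ᵥ (((1 / 2 : ℝ) • P + (1 / 2 : ℝ) • R) *ᵥ x) = 0 := by rw [hx, dotProduct_zero]
    rw [add_mulVec, smul_mulVec, smul_mulVec, dotProduct_add, dotProduct_smul, dotProduct_smul,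
      smul_eq_mul, smul_eq_mul] at h3
    exact ⟨(hP.dotProduct_mulVec_zero_iff x).mp (by linarith),
      (hRp.dotProduct_mulVec_zero_iff x).mp (by linarith)⟩
  refine lt_of_le_of_ne (fun x hx => (key x hx).1) fun he => ?_
  have hvk : v ∈ LinearMap.ker P.mulVecLin := hPv
  rw [← he] at hvk
  exact hR (by rw [(key v hvk).2, dotProduct_zero])

end PosDef

/-! ### Faces of the cone and facial reduction under perturbation. -/

section Faces

variable {n : ℕ}

lemma isFace_minimalFace {V : Type*} [AddCommGroup V] [Module ℝ V] {C S : Set V}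
    (hC : Convex ℝ C) (hS : S ⊆ C) : IsFace C (minimalFace C S) :=
  ⟨convex_sInter fun _ hF => hF.1.1,
    isExtreme_sInter ⟨C, ⟨hC, IsExtreme.rfl⟩, hS⟩ fun _ hF => hF.1.2⟩

lemma subset_minimalFace {V : Type*} [AddCommGroup V] [Module ℝ V] (C S : Set V) :
    S ⊆ minimalFace C S :=
  Set.subset_sInter fun _ hF => hF.2

lemma minimalFace_subset {V : Type*} [AddCommGroup V] [Module ℝ V] {C S F : Set V}
    (hF : IsFace C F) (hS : S ⊆ F) : minimalFace C S ⊆ F :=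
  Set.sInter_subset_of_mem ⟨hF, hS⟩

lemma convex_psdCone (n : ℕ) : Convex ℝ (psdCone n) :=
  fun _ hX _ hY _ _ ha hb _ => (PosSemidef.smul hX ha).add (PosSemidef.smul hY hb)

/-- The zero set in a convex set `C` of a linear functional that is nonnegative on `C` is a face. -/
lemma isFace_inter_zeros {V : Type*} [AddCommGroup V] [Module ℝ V] {C : Set V}
    (hC : Convex ℝ C) (φ : V →ₗ[ℝ] ℝ) (hφ : ∀ x ∈ C, 0 ≤ φ x) :
    IsFace C {x | x ∈ C ∧ φ x = 0} := by
  refine ⟨fun x hx y hy a b ha hb hab => ⟨hC hx.1 hy.1 ha hb hab, ?_⟩, fun x hx => hx.1, ?_⟩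
  · simp [hx.2, hy.2]
  · rintro x hx y hy z ⟨hz, hz0⟩ ⟨a, b, ha, hb, -, rfl⟩
    refine ⟨hx, ?_⟩
    rw [map_add, map_smul, map_smul, smul_eq_mul, smul_eq_mul] at hz0
    have h1 := hφ x hx
    have h2 := mul_nonneg hb.le (hφ y hy)
    have h3 := mul_nonneg ha.le h1
    have : a * φ x = 0 := by linarith
    exact (mul_eq_zero.mp this).resolve_left ha.ne'

lemma feasibleD_subset_psdCone {m : ℕ} (A : Fin m → Matrix (Fin n) (Fin n) ℝ)
    (b : EuclideanSpace ℝ (Fin m)) : feasibleD A b ⊆ psdCone n :=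
  fun _ hX => hX.1

lemma convex_feasibleD {m : ℕ} (A : Fin m → Matrix (Fin n) (Fin n) ℝ)
    (b : EuclideanSpace ℝ (Fin m)) : Convex ℝ (feasibleD A b) := by
  intro X hX Y hY c d hc hd hcd
  refine ⟨convex_psdCone n hX.1 hY.1 hc hd hcd, fun k => ?_⟩
  rw [frob_add_right, frob_smul_right, frob_smul_right, hX.2, hY.2, ← add_mul, hcd, one_mul]

lemma minFaceD_subset_psdCone {m : ℕ} (A : Fin m → Matrix (Fin n) (Fin n) ℝ)
    (b : EuclideanSpace ℝ (Fin m)) : minFaceD A b ⊆ psdCone n :=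
  minimalFace_subset ⟨convex_psdCone n, IsExtreme.rfl⟩ (feasibleD_subset_psdCone A b)

/-- If every reducing certificate of a facial reduction sequence annihilates the perturbation, the
perturbed feasible region stays in the minimal face. -/
lemma feasibleD_add_subset_minFaceD {m s : ℕ} {A : Fin m → Matrix (Fin n) (Fin n) ℝ}
    {b : EuclideanSpace ℝ (Fin m)} {y : Fin s → EuclideanSpace ℝ (Fin m)}
    {U V : Fin s → Matrix (Fin n) (Fin n) ℝ} (hseq : IsFacialReductionSequence A b y U V)
    {D : Fin m → Matrix (Fin n) (Fin n) ℝ} (hD : ∀ i, ∑ k, y i k • D k = 0) :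
    feasibleD (fun k => A k + D k) b ⊆ minFaceD A b := by
  obtain ⟨F, h0, hstep, hlast⟩ := hseq
  intro X hX
  rw [← hlast]
  induction Fin.last s using Fin.induction with
  | zero => rw [h0]; exact hX.1
  | succ i ih =>
    obtain ⟨⟨-, hV, hb, hUV, -⟩, hF⟩ := hstep i
    rw [hF]
    refine ⟨ih, ?_⟩
    -- The certificate still pairs with `X` to `-bᵀ y i = 0`; the `V i` part vanishes because `X`
    -- already lies in the current face.
    have h1 : frob (U i + V i) X = 0 := by
      have : -∑ k, y i k • (A k + D k) = U i + V i := by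
        simp only [smul_add, Finset.sum_add_distrib, hD i, add_zero, hUV]
      rw [← this, frob_neg_left, frob_sum_left, neg_eq_zero, ← hb]
      refine Finset.sum_congr rfl fun k _ => ?_
      rw [frob_smul_left, hX.2 k, mul_comm]
    rw [frob_add_left, hV.2 X ih, add_zero] at h1
    exact (frob_comm _ _).trans h1

end Faces

/-! ### Stability of linear systems of constant rank. -/

section Gram

variable {κ : Type*} {r : ℕ}

/-- The Gram matrix of a family of matrices with respect to `frob`. -/
def frobGram (C : κ → Matrix (Fin r) (Fin r) ℝ) : Matrix κ κ ℝ :=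
  of fun i j => frob (C i) (C j)

lemma tendsto_frob {T : Type*} {l : Filter T} {A B : T → Matrix (Fin r) (Fin r) ℝ}
    {A₀ B₀ : Matrix (Fin r) (Fin r) ℝ} (hA : Tendsto A l (𝓝 A₀)) (hB : Tendsto B l (𝓝 B₀)) :
    Tendsto (fun t => frob (A t) (B t)) l (𝓝 (frob A₀ B₀)) :=
  tendsto_finsetSum _ fun i _ => tendsto_finsetSum _ fun j _ =>
    ((tendsto_pi_nhds.mp (tendsto_pi_nhds.mp hA i) j).mul
      (tendsto_pi_nhds.mp (tendsto_pi_nhds.mp hB i) j))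

lemma tendsto_frobGram {T : Type*} {l : Filter T} {C : κ → T → Matrix (Fin r) (Fin r) ℝ}
    {C₀ : κ → Matrix (Fin r) (Fin r) ℝ} (hC : ∀ i, Tendsto (C i) l (𝓝 (C₀ i))) :
    Tendsto (fun t => frobGram fun i => C i t) l (𝓝 (frobGram C₀)) :=
  tendsto_pi_nhds.mpr fun i => tendsto_pi_nhds.mpr fun j => tendsto_frob (hC i) (hC j)

variable [Fintype κ]

lemma frobGram_mulVec (C : κ → Matrix (Fin r) (Fin r) ℝ) (c : κ → ℝ) (i : κ) :
    (frobGram C *ᵥ c) i = frob (C i) (∑ j, c j • C j) := by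
  simp only [mulVec, dotProduct, frobGram, of_apply, frob_sum_right, frob_smul_right, mul_comm]

/-- A kernel vector `c` of the Gram matrix makes `∑ j, c j • C j` orthogonal to every `C i`, hence
to itself. -/
lemma det_frobGram_ne_zero_iff [DecidableEq κ] {C : κ → Matrix (Fin r) (Fin r) ℝ} :
    (frobGram C).det ≠ 0 ↔ LinearIndependent ℝ C := by
  rw [Fintype.linearIndependent_iff]
  constructor
  · intro hdet c hc
    have : frobGram C *ᵥ c = 0 := by
      ext i
      rw [frobGram_mulVec, hc]
      simp [frob]
    exact congrFun (eq_zero_of_mulVec_eq_zero hdet this)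
  · intro h hdet
    obtain ⟨c, hc0, hc⟩ := exists_mulVec_eq_zero_iff.mpr hdet
    refine hc0 (funext (h c (eq_zero_of_frob_self ?_)))
    rw [frob_sum_left]
    refine Finset.sum_eq_zero fun i _ => ?_
    rw [frob_smul_left, ← frobGram_mulVec, hc, Pi.zero_apply, mul_zero]

/-- Linearly independent systems of matrix equations have solutions depending continuously on the
coefficients. -/
lemma exists_tendsto_frob_eq_of_linearIndependent {T : Type*} {l : Filter T}
    {C : κ → T → Matrix (Fin r) (Fin r) ℝ} {C₀ : κ → Matrix (Fin r) (Fin r) ℝ}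
    (hC : ∀ i, Tendsto (C i) l (𝓝 (C₀ i))) (hli : LinearIndependent ℝ C₀) {b : κ → ℝ}
    {P₀ : Matrix (Fin r) (Fin r) ℝ} (hP₀ : ∀ i, frob (C₀ i) P₀ = b i) :
    ∃ P : T → Matrix (Fin r) (Fin r) ℝ, Tendsto P l (𝓝 P₀) ∧
      (∀ t, P t - P₀ ∈ Submodule.span ℝ (Set.range fun i => C i t)) ∧
      ∀ᶠ t in l, (LinearIndependent ℝ fun i => C i t) ∧ ∀ i, frob (C i t) (P t) = b i := by
  classical
  have hG := tendsto_frobGram hC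
  have hdet₀ : (frobGram C₀).det ≠ 0 := det_frobGram_ne_zero_iff.mpr hli
  have hdet : ∀ᶠ t in l, (frobGram fun i => C i t).det ≠ 0 :=
    ((continuous_id.matrix_det.tendsto _).comp hG).eventually_ne hdet₀
  -- Coefficients of the correction in the span of the `C i t` that cancels the residual of `P₀`.
  -- Where the Gram matrix is singular the inverse is zero by convention, which is harmless: that
  -- eventually stops occurring.
  obtain ⟨c, hc⟩ : ∃ c : T → κ → ℝ, ∀ t,
      c t = (frobGram fun i => C i t)⁻¹ *ᵥ fun i => b i - frob (C i t) P₀ := ⟨_, fun _ => rfl⟩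
  have hclim : Tendsto c l (𝓝 0) := by
    have h1 : Tendsto (fun t => (frobGram fun i => C i t)⁻¹) l (𝓝 (frobGram C₀)⁻¹) := by
      refine (continuousAt_matrix_inv _ ?_).tendsto.comp hG
      rw [Ring.inverse_eq_inv']
      exact continuousAt_inv₀ hdet₀
    have h2 : Tendsto (fun t i => b i - frob (C i t) P₀) l (𝓝 0) := by
      refine tendsto_pi_nhds.mpr fun i => ?_
      have := (tendsto_frob (hC i) (tendsto_const_nhds (x := P₀))).const_sub (b i)
      rwa [hP₀, sub_self] at this
    have h3 : Continuous fun p : Matrix κ κ ℝ × (κ → ℝ) => p.1 *ᵥ p.2 :=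
      continuous_fst.matrix_mulVec continuous_snd
    have h4 := (h3.tendsto ((frobGram C₀)⁻¹, 0)).comp (h1.prodMk_nhds h2)
    rw [mulVec_zero] at h4
    exact h4.congr fun t => (hc t).symm
  refine ⟨fun t => P₀ + ∑ i, c t i • C i t, ?_, fun t => ?_, ?_⟩
  · have : Tendsto (fun t => ∑ i, c t i • C i t) l (𝓝 (∑ i, (0 : ℝ) • C₀ i)) :=
      tendsto_finsetSum _ fun i _ => (tendsto_pi_nhds.mp hclim i).smul (hC i)
    simpa using this.const_add P₀
  · rw [add_sub_cancel_left]
    exact Submodule.sum_mem _ fun i _ =>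
      Submodule.smul_mem _ _ (Submodule.subset_span ⟨i, rfl⟩)
  · filter_upwards [hdet] with t ht
    refine ⟨det_frobGram_ne_zero_iff.mp ht, fun i => ?_⟩
    rw [frob_add_right, ← frobGram_mulVec (fun i => C i t), hc, mulVec_mulVec,
      mul_nonsing_inv _ (isUnit_iff_ne_zero.mpr ht), one_mulVec]
    ring

/-- Under a constant rank condition, a solution of a consistent linear system of matrix equations
extends to solutions of the perturbed systems that depend continuously on the perturbation and
differ from it by an element of the span of the coefficient matrices. -/
lemma exists_tendsto_frob_eq {T ι : Type*} [Finite ι] {l : Filter T}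
    {B : ι → T → Matrix (Fin r) (Fin r) ℝ} {B₀ : ι → Matrix (Fin r) (Fin r) ℝ}
    (hB : ∀ k, Tendsto (B k) l (𝓝 (B₀ k)))
    (hrank : ∀ᶠ t in l, Module.finrank ℝ (Submodule.span ℝ (Set.range fun k => B k t)) =
      Module.finrank ℝ (Submodule.span ℝ (Set.range B₀)))
    {b : ι → ℝ} (hcons : ∀ᶠ t in l, ∃ X, ∀ k, frob (B k t) X = b k)
    {P₀ : Matrix (Fin r) (Fin r) ℝ} (hP₀ : ∀ k, frob (B₀ k) P₀ = b k) :
    ∃ P : T → Matrix (Fin r) (Fin r) ℝ, Tendsto P l (𝓝 P₀) ∧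
      (∀ t, P t - P₀ ∈ Submodule.span ℝ (Set.range fun k => B k t)) ∧
      ∀ᶠ t in l, ∀ k, frob (B k t) (P t) = b k := by
  obtain ⟨κ, a, hinj, hspan, hli⟩ := exists_linearIndependent' ℝ B₀
  have := Finite.of_injective a hinj
  have := Fintype.ofFinite κ
  obtain ⟨P, hP, hPspan, hPsol⟩ := exists_tendsto_frob_eq_of_linearIndependent
    (C := fun i => B (a i)) (fun i => hB (a i)) hli fun i => hP₀ (a i)
  have hle : ∀ t, Submodule.span ℝ (Set.range fun i => B (a i) t) ≤
      Submodule.span ℝ (Set.range fun k => B k t) := by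
    intro t
    refine Submodule.span_mono ?_
    rintro _ ⟨i, rfl⟩
    exact ⟨a i, rfl⟩
  refine ⟨P, hP, fun t => hle t (hPspan t), ?_⟩
  filter_upwards [hPsol, hrank, hcons] with t ⟨hlt, hsol⟩ hrk ⟨X, hX⟩ k
  -- The subfamily `a`, a basis of the limiting span, stays independent, so by constant rank it
  -- still spans. Consistency then makes the remaining equations follow from those indexed by `a`.
  have heq := Submodule.eq_of_le_of_finrank_eq (hle t) (by
    rw [hrk, ← hspan, finrank_span_eq_card hlt, finrank_span_eq_card hli])
  have hk : B k t ∈ Submodule.span ℝ (Set.range fun i => B (a i) t) :=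
    heq ▸ Submodule.subset_span ⟨k, rfl⟩
  obtain ⟨d, hd⟩ := (Submodule.mem_span_range_iff_exists_fun ℝ).mp hk
  rw [← hX k, ← hd, frob_sum_left, frob_sum_left]
  refine Finset.sum_congr rfl fun i _ => ?_
  rw [frob_smul_left, frob_smul_left, hsol, hX]

end Gram

/-! ### Relative interior points of the minimal face. -/

section Representation

variable {n r m : ℕ} {h : r ≤ n} {Q : Matrix (Fin n) (Fin n) ℝ}

/-- The minimal face is spanned by a feasible point that is positive definite on its block. -/
lemma exists_posDef_feasibleD {A : Fin m → Matrix (Fin n) (Fin n) ℝ}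
    {b : EuclideanSpace ℝ (Fin m)} (hne : (feasibleD A b).Nonempty)
    (hQ : Q ∈ orthogonalGroup (Fin n) ℝ)
    (hF : minFaceD A b = {Y | ∃ X ∈ psdCone r, Y = Q * embedLowerRight h X * Qᵀ}) :
    ∃ P : Matrix (Fin r) (Fin r) ℝ, P.PosDef ∧
      Q * embedLowerRight h P * Qᵀ ∈ feasibleD A b := by
  have hsub : feasibleD A b ⊆ minFaceD A b := subset_minimalFace _ _
  let S : Set (Matrix (Fin r) (Fin r) ℝ) :=
    {P | P ∈ psdCone r ∧ Q * embedLowerRight h P * Qᵀ ∈ feasibleD A b}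
  have hS : Convex ℝ S := by
    intro P hP R hR c d hc hd hcd
    refine ⟨convex_psdCone r hP.1 hR.1 hc hd hcd, ?_⟩
    have := convex_feasibleD A b hP.2 hR.2 hc hd hcd
    simpa only [embedLowerRight_add, embedLowerRight_smul, mul_add, add_mul, Matrix.mul_smul,
      Matrix.smul_mul] using this
  have hSne : S.Nonempty := by
    obtain ⟨X, hX⟩ := hne
    have hXF := hsub hX
    rw [hF] at hXF
    obtain ⟨P, hP, rfl⟩ := hXF
    exact ⟨P, hP, hX⟩
  obtain ⟨P, hP, hPD⟩ := exists_posDef_mem_of_convex hS hSne (fun _ hP => hP.1) (by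
    intro v hv
    by_contra! hcon
    -- If `v` were isotropic for every feasible block, the zeros of `φ` in the cone would form a
    -- face containing the minimal face; but the identity block gives `v ⬝ᵥ v ≠ 0`.
    let φ : Matrix (Fin n) (Fin n) ℝ →ₗ[ℝ] ℝ :=
      { toFun := fun Y => v ⬝ᵥ lowerRight h (Qᵀ * Y * Q) *ᵥ v
        map_add' := fun X Y => by
          rw [mul_add, add_mul, lowerRight_add, add_mulVec, dotProduct_add]
        map_smul' := fun c X => by
          rw [Matrix.mul_smul, Matrix.smul_mul, lowerRight_smul, smul_mulVec, dotProduct_smul,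
            RingHom.id_apply] }
    have hφ : ∀ Y ∈ psdCone n, 0 ≤ φ Y := by
      intro Y hY
      have h1 : (Qᵀ * Y * Q).PosSemidef := by
        simpa using PosSemidef.conjTranspose_mul_mul_same hY Q
      exact (posSemidef_lowerRight h h1).dotProduct_mulVec_nonneg v
    have hface := minimalFace_subset (isFace_inter_zeros (convex_psdCone n) φ hφ)
      (S := feasibleD A b) (by
        intro Y hY
        refine ⟨hY.1, ?_⟩
        have hYF := hsub hY
        rw [hF] at hYF
        obtain ⟨P, hP, rfl⟩ := hYF
        change v ⬝ᵥ lowerRight h (Qᵀ * (Q * embedLowerRight h P * Qᵀ) * Q) *ᵥ v = 0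
        rw [lowerRight_conj_embedLowerRight h hQ]
        exact hcon P ⟨hP, hY⟩)
    have hone : Q * embedLowerRight h 1 * Qᵀ ∈ minFaceD A b := by
      rw [hF]
      exact ⟨1, PosSemidef.one, rfl⟩
    have h0 : v ⬝ᵥ lowerRight h (Qᵀ * (Q * embedLowerRight h 1 * Qᵀ) * Q) *ᵥ v = 0 :=
      (hface hone).2
    rw [lowerRight_conj_embedLowerRight h hQ, one_mulVec] at h0
    exact hv (dotProduct_self_eq_zero.mp h0))
  exact ⟨P, hPD, hP.2⟩

/-- A face of the semidefinite cone that contains a point of a face `Q (0 ⊕ 𝕊₊) Qᵀ` with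
positive definite block contains this face. -/
lemma subset_isFace_of_posDef {F F' : Set (Matrix (Fin n) (Fin n) ℝ)}
    (hF : F = {Y | ∃ X ∈ psdCone r, Y = Q * embedLowerRight h X * Qᵀ}) (hFp : F ⊆ psdCone n)
    (hF' : IsFace (psdCone n) F') {P : Matrix (Fin r) (Fin r) ℝ} (hP : P.PosDef)
    (hPF : Q * embedLowerRight h P * Qᵀ ∈ F') : F ⊆ F' := by
  intro Y hY
  have hYp := hFp hY
  rw [hF] at hY
  obtain ⟨W, hW, rfl⟩ := hY
  -- Moving from `W` slightly past `P` stays positive definite, so `P` is interior to a segment of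
  -- the cone ending at `W`.
  have hlim : Tendsto (fun ε : ℝ => P + ε • (P - W)) (𝓝[>] 0) (𝓝 P) := by
    have : Continuous fun ε : ℝ => P + ε • (P - W) := by fun_prop
    simpa using (this.tendsto 0).mono_left nhdsWithin_le_nhds
  obtain ⟨ε, hε, hε0⟩ := ((hlim.eventually (eventually_posDef_of_posDef hP)).and
    self_mem_nhdsWithin).exists
  have hε0 : 0 < ε := hε0
  have hPs : P.IsSymm := by simpa using hP.1
  have hWs : W.IsSymm := hW.1
  have hR := hε (hPs.add ((hPs.sub hWs).smul ε))
  have hRF : Q * embedLowerRight h (P + ε • (P - W)) * Qᵀ ∈ psdCone n := by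
    refine hFp ?_
    rw [hF]
    exact ⟨_, hR.posSemidef, rfl⟩
  refine hF'.2.left_mem_of_mem_openSegment hYp hRF hPF
    ⟨ε / (1 + ε), 1 / (1 + ε), by positivity, by positivity, by field_simp; ring, ?_⟩
  have hcomb : (ε / (1 + ε)) • W + (1 / (1 + ε)) • (P + ε • (P - W)) = P := by
    have h1 : (1 + ε) ≠ 0 := by positivity
    ext i j
    simp only [Matrix.add_apply, Matrix.smul_apply, Matrix.sub_apply, smul_eq_mul]
    field_simp
    ring
  rw [← Matrix.smul_mul, ← Matrix.mul_smul, ← Matrix.smul_mul, ← Matrix.mul_smul, ← add_mul, ← mul_add,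
    ← embedLowerRight_smul, ← embedLowerRight_smul, ← embedLowerRight_add, hcomb]

end Representation

end SDPFace

/-! ### Equality of the minimal faces. -/

theorem mainTheorem9 {n m s : ℕ}
    -- the data of the problem
    (A₀ : Matrix (Fin n) (Fin n) ℝ) (A : Fin m → Matrix (Fin n) (Fin n) ℝ)
    (b : EuclideanSpace ℝ (Fin m))
    (hA₀ : A₀.IsSymm) (hA : ∀ k, (A k).IsSymm)
    -- the perturbations, symmetric, vanishing and continuous at `t = 0`
    (E : Fin m → ℝ → Matrix (Fin n) (Fin n) ℝ)
    (hEsymm : ∀ k, ∀ t ≥ 0, (E k t).IsSymm)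
    (hEzero : ∀ k, E k 0 = 0)
    (hEcont : ∀ k, ContinuousWithinAt (E k) (Set.Ici 0) 0)
    (hD : SDPFace.ConditionD A₀ A b E)
    (hrank : SDPFace.RankCondition A b E)
    -- a facial reduction sequence of the unperturbed problem
    (y : Fin s → EuclideanSpace ℝ (Fin m)) (U V : Fin s → Matrix (Fin n) (Fin n) ℝ)
    (hseq : SDPFace.IsFacialReductionSequence A b y U V)
    -- the form of the perturbations for small `t > 0`
    (w : ℝ → EuclideanSpace ℝ (Fin m)) (G : ℝ → Matrix (Fin n) (Fin n) ℝ)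
    (hGsymm : ∀ᶠ t in 𝓝[>] (0 : ℝ), (G t).IsSymm)
    (hGlim : Tendsto G (𝓝[>] 0) (𝓝 0))
    (hw : ∀ᶠ t in 𝓝[>] (0 : ℝ), w t ∈ (Submodule.span ℝ (Set.range y))ᗮ)
    (hform : ∀ᶠ t in 𝓝[>] (0 : ℝ), ∀ k, E k t = w t k • G t) :
    ∀ᶠ t in 𝓝[>] (0 : ℝ),
      SDPFace.minFaceD (fun k => A k + E k t) b = SDPFace.minFaceD A b := by
  open SDPFace Matrix in
  obtain ⟨r, h, Q, hQ, hF, δ, hδ, hrk⟩ := hrank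
  have hEt : ∀ k, Tendsto (E k) (𝓝[>] 0) (𝓝 0) := fun k => by
    simpa [ContinuousWithinAt, hEzero k] using
      (hEcont k).tendsto.mono_left (nhdsWithin_mono _ Set.Ioi_subset_Ici_self)
  have hann : ∀ᶠ t in 𝓝[>] (0 : ℝ), ∀ i, ∑ k, y i k • E k t = 0 := by
    filter_upwards [hw, hform] with t hwt hft i
    have h0 : inner ℝ (y i) (w t) = 0 :=
      (Submodule.mem_orthogonal _ _).mp hwt _ (Submodule.subset_span ⟨i, rfl⟩)
    rw [PiLp.inner_apply] at h0
    simp only [hft, smul_smul, ← Finset.sum_smul]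
    rw [show ∑ k, y i k * w t k = 0 by simpa [mul_comm] using h0, zero_smul]
  have hsub : ∀ᶠ t in 𝓝[>] (0 : ℝ), feasibleD (fun k => A k + E k t) b ⊆ minFaceD A b :=
    hann.mono fun t ht => feasibleD_add_subset_minFaceD hseq ht
  obtain ⟨P₀, hP₀, hP₀f⟩ := exists_posDef_feasibleD hD.dual_feasible hQ hF
  have hblock : ∀ (M : Matrix (Fin n) (Fin n) ℝ) (X : Matrix (Fin r) (Fin r) ℝ),
      frob M (Q * embedLowerRight h X * Qᵀ) = frob (lowerRight h (Qᵀ * M * Q)) X :=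
    fun M X => by rw [frob_mul_mul_transpose, frob_embedLowerRight]
  obtain ⟨P, hPlim, hPspan, hPsol⟩ := exists_tendsto_frob_eq (l := 𝓝[>] (0 : ℝ))
    (B := fun k t => lowerRight h (Qᵀ * (A k + E k t) * Q))
    (B₀ := fun k => lowerRight h (Qᵀ * A k * Q)) (b := b) (P₀ := P₀)
    (fun k => by
      have hc : Continuous fun M => lowerRight h (Qᵀ * (A k + M) * Q) :=
        (continuous_lowerRight h).comp (by fun_prop)
      have hlim := (hc.tendsto 0).comp (hEt k)
      rw [add_zero] at hlim
      exact hlim)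
    (by
      filter_upwards [Ioc_mem_nhdsGT hδ] with t ht
      exact hrk t ⟨ht.1.le, ht.2⟩)
    (by
      -- A perturbed feasible point lies in the old face, so its block solves the reduced system.
      filter_upwards [hD.perturbed_feasible, hsub] with t ⟨X, hX⟩ ht
      have hXF := ht hX
      rw [hF] at hXF
      obtain ⟨R, -, rfl⟩ := hXF
      exact ⟨R, fun k => (hblock _ _).symm.trans (hX.2 k)⟩)
    (fun k => (hblock _ _).symm.trans (hP₀f.2 k))
  filter_upwards [hsub, hPsol, hPlim.eventually (eventually_posDef_of_posDef hP₀),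
    self_mem_nhdsWithin] with t hst hsol hpd ht
  -- Positive definiteness is open only among symmetric matrices. The correction `P t - P₀` is
  -- symmetric because it lies in the span of symmetric blocks, realized below as part of the kernel
  -- of transposition minus the identity.
  have hsymm : (P t).IsSymm := by
    have hle : Submodule.span ℝ (Set.range fun k => lowerRight h (Qᵀ * (A k + E k t) * Q)) ≤
        LinearMap.ker ((transposeLinearEquiv (Fin r) (Fin r) ℝ ℝ).toLinearMap -
          LinearMap.id) := by
      rw [Submodule.span_le]
      rintro _ ⟨k, rfl⟩
      have hk : (A k + E k t).IsSymm := (hA k).add (hEsymm k t (le_of_lt ht))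
      have hkQ : (Qᵀ * (A k + E k t) * Q).IsSymm := by
        simp only [IsSymm, transpose_mul, transpose_transpose, hk.eq, mul_assoc]
      exact sub_eq_zero.mpr (isSymm_lowerRight h hkQ)
    have h1 : (P t - P₀).IsSymm := sub_eq_zero.mp (hle (hPspan t))
    have h2 : P₀.IsSymm := by simpa using hP₀.1
    simpa using h1.add h2
  have hPD := hpd hsymm
  have hPF : Q * embedLowerRight h (P t) * Qᵀ ∈ minFaceD A b := by
    rw [hF]
    exact ⟨_, hPD.posSemidef, rfl⟩
  have hfeas : Q * embedLowerRight h (P t) * Qᵀ ∈ feasibleD (fun k => A k + E k t) b :=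
    ⟨minFaceD_subset_psdCone A b hPF, fun k => (hblock _ _).trans (hsol k)⟩
  refine Set.Subset.antisymm (minimalFace_subset
    (isFace_minimalFace (convex_psdCone n) (feasibleD_subset_psdCone A b)) hst) ?_
  exact subset_isFace_of_posDef hF (minFaceD_subset_psdCone A b)
    (isFace_minimalFace (convex_psdCone n) (feasibleD_subset_psdCone _ b)) hPD
    (subset_minimalFace _ _ hfeas)
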